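/- Let $(\Omega,\mathcal F,P)$ be a probability space, $L^\infty_+$ the set of a.s. nonnegative essentially bounded random variables, and $L^\infty_{++}$ the set of essentially bounded $X$ with $X\ge c$ a.s. for some constant $c>0$. Let $\Phi:[0,+\infty)\to\mathbb R\cup\{\pm\infty\}$ be an Orlicz function: $\Phi(x)>-\infty$ for $x>0$, $\Phi(x)\le 1$ for $x\le 1$, $\Phi(x)>1$ for $x>1$, and $\Phi$ is nondecreasing and left-continuous. For $X\in L^\infty_+$ let \[ H_\Phi(X)=\inf\{k>0 \mid \mathbb E_P[\Phi(X/k)]\le 1\}, \] with $H_\Phi(X)=0$ by definition if $P(X=0)>0$ and $\Phi(0)=-\infty$. Assume that $\Phi$ is GA-convex, i.e. $\Phi(x^\lambda y^{1-\lambda})\le \lambda\Phi(x)+(1-\lambda)\Phi(y)$ for all $x,y\in[0,+\infty)$ and $\lambda\in(0,1)$, where $-\infty+\infty=+\infty$. Let $\mathbf P$ be the set of probability measures on $(\Omega,\mathcal F)$ that are absolutely continuous with respect to $P$, and for $Q\in\mathbf P$ put \[ \alpha(Q)=\Big[\sup\big\{\exp(\mathbb E_Q[\log X]) \;\big|\;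 X\in L^\infty_{++},\ \mathbb E_P[\Phi(X)]\le 1\big\}\Big]^{-1}, \qquad (+\infty)^{-1}=0 . \] Then $\alpha(Q)\in[0,1]$ for every $Q\in\mathbf P$, and for every $X\in L^\infty_{++}$ \[ H_\Phi(X)=\sup_{Q\in\mathbf P}\big\{\alpha(Q)\exp(\mathbb E_Q[\log X])\big\}. \] -/

import Mathlib

open MeasureTheory
open scoped NNReal ENNReal

noncomputable section

/-- Addition of extended reals with the convention `-∞ + ∞ = ∞`
(Mathlib's addition on `EReal` uses `-∞ + ∞ = -∞`). -/
def upperAdd (a b : EReal) : EReal :=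
  open Classical in if a = ⊤ ∨ b = ⊤ then ⊤ else a + b

/-- Expectation `E[Z] = E[Z⁺] - E[Z⁻]` of an extended-real-valued random variable, with the
convention `∞ - ∞ = ∞`. -/
def extExpectation {Ω : Type*} [MeasurableSpace Ω] (P : Measure Ω) (Z : Ω → EReal) : EReal :=
  upperAdd ((∫⁻ ω, (Z ω).toENNReal ∂P : ℝ≥0∞) : EReal)
    (-((∫⁻ ω, (-Z ω).toENNReal ∂P : ℝ≥0∞) : EReal))

/-- Orlicz functions `Φ : [0, ∞) → ℝ ∪ {±∞}`. -/
structure IsOrliczFunction (Φ : ℝ≥0 → EReal) : Prop where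
  ne_bot : ∀ x, 0 < x → Φ x ≠ ⊥
  le_one : ∀ x, x ≤ 1 → Φ x ≤ 1
  one_lt : ∀ x, 1 < x → 1 < Φ x
  mono : Monotone Φ
  left_cont : ∀ x, ContinuousWithinAt Φ (Set.Iic x) x

/-- Geometric-arithmetic convexity of `f : [0, ∞) → [-∞, ∞]`, with `-∞ + ∞ = ∞`. -/
def GAConvex (f : ℝ≥0 → EReal) : Prop :=
  ∀ x y : ℝ≥0, ∀ l : ℝ, 0 < l → l < 1 →
    f (x ^ l * y ^ (1 - l)) ≤
      upperAdd ((l : EReal) * f x) (((1 - l : ℝ) : EReal) * f y)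

/-- The (generalized) Orlicz premium
`H_Φ(X) = inf {k > 0 | E[Φ(X / k)] ≤ 1}` of an essentially bounded, a.s. nonnegative `X`;
it is `0` by definition if `P(X = 0) > 0` and `Φ(0) = -∞`. -/
def orliczPremium {Ω : Type*} [MeasurableSpace Ω] (P : Measure Ω) (Φ : ℝ≥0 → EReal)
    (X : Ω → ℝ) : ℝ :=
  open Classical in
  if 0 < P {ω | X ω = 0} ∧ Φ 0 = ⊥ then 0
  else sInf {k : ℝ | 0 < k ∧ extExpectation P (fun ω => Φ (X ω / k).toNNReal) ≤ 1}

/-- `X ∈ L^∞_{++}(P)`: `X` is essentially bounded and `X ≥ c` a.s. for some constant `c > 0`. -/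
def MemLinftyPosPos {Ω : Type*} [MeasurableSpace Ω] (P : Measure Ω) (X : Ω → ℝ) : Prop :=
  MemLp X ∞ P ∧ ∃ c : ℝ, 0 < c ∧ ∀ᵐ ω ∂P, c ≤ X ω

/-- The set of probability measures that are absolutely continuous with respect to `P`. -/
def absContProbs {Ω : Type*} [MeasurableSpace Ω] (P : Measure Ω) : Set (Measure Ω) :=
  {Q | IsProbabilityMeasure Q ∧ Q ≪ P}

/-- The geometric mean `exp (E_Q[log X])`, for `X ∈ L^∞_{++}(P)` and `Q ≪ P` a probability
(so that `log X` is `Q`-a.s. bounded). -/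
def geomMean {Ω : Type*} [MeasurableSpace Ω] (Q : Measure Ω) (X : Ω → ℝ) : ℝ≥0∞ :=
  ENNReal.ofReal (Real.exp (∫ ω, Real.log (X ω) ∂Q))

/-- The penalty `α(Q) = [sup {exp (E_Q[log X]) | X ∈ L^∞_{++}(P), E_P[Φ(X)] ≤ 1}]⁻¹`,
with `∞⁻¹ = 0`. -/
def orliczPenalty {Ω : Type*} [MeasurableSpace Ω] (P : Measure Ω) (Φ : ℝ≥0 → EReal)
    (Q : Measure Ω) : ℝ≥0∞ :=
  (⨆ X ∈ {X : Ω → ℝ | MemLinftyPosPos P X ∧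
      extExpectation P (fun ω => Φ (X ω).toNNReal) ≤ 1}, geomMean Q X)⁻¹

end

/-! ### Extended expectations reduced to ordinary integrals -/

section ExtExpectation

variable {Ω : Type*} [MeasurableSpace Ω] {P : Measure Ω}

/-! Put `f x = Φ (exp x)` and pass to `Y = log X`: GA-convexity turns `f` into a convex
nondecreasing function, and the claim becomes a duality for bounded `Y`.

Weak half (`orliczPenalty_mul_geomMean_le`): if `k` is admissible for `X`, then `X / k` competes in
the supremum defining the penalty.

Strong half (`exists_le_orliczPenalty_mul_geomMean`): for `k < k' < H_Φ(X)`, `E[f(log (X / k'))] >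
1`. It suffices to find `Q` under which no acceptable `Z` has a larger mean than `log (X / k')` plus
the slack `δ = log k' - log k`. This `Q` is explicit (`exists_separating`), with no Hahn–Banach
argument: its density is proportional to the right derivative of `f` at `Y`. When `Y` comes too
close to, or passes, the right end of the domain of `f`, `Q` is instead `P` conditioned on `Y` being
large, and `δ` absorbs the error. -/

theorem upperAdd_coe (a b : ℝ) : upperAdd (a : EReal) (b : EReal) = ((a + b : ℝ) : EReal) := by
  simp [upperAdd]

theorem extExpectation_congr_ae {Z W : Ω → EReal} (h : Z =ᵐ[P] W) :
    extExpectation P Z = extExpectation P W := by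
  unfold extExpectation
  rw [lintegral_congr_ae (h.mono fun ω hω => by simp only [hω] :
      (fun ω => (Z ω).toENNReal) =ᵐ[P] fun ω => (W ω).toENNReal),
    lintegral_congr_ae (h.mono fun ω hω => by simp only [hω] :
      (fun ω => (-Z ω).toENNReal) =ᵐ[P] fun ω => (-W ω).toENNReal)]

theorem extExpectation_coe {W : Ω → ℝ} (hW : Integrable W P) :
    extExpectation P (fun ω => (W ω : EReal)) = ((∫ ω, W ω ∂P : ℝ) : EReal) := by
  have hpos : ∫⁻ ω, ENNReal.ofReal (W ω) ∂P ≠ ⊤ := hW.lintegral_lt_top.ne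
  have hneg : ∫⁻ ω, ENNReal.ofReal (-W ω) ∂P ≠ ⊤ := hW.neg.lintegral_lt_top.ne
  rw [integral_eq_lintegral_pos_part_sub_lintegral_neg_part hW]
  unfold extExpectation
  simp only [← EReal.coe_neg, EReal.real_coe_toENNReal]
  rw [← EReal.coe_ennreal_toReal hpos, ← EReal.coe_ennreal_toReal hneg, ← EReal.coe_neg,
    upperAdd_coe, sub_eq_add_neg]

/-- A random variable that is bounded below and whose expectation is not `+∞` is a.s. equal to a
real-valued integrable one. -/
theorem exists_integrable_of_extExpectation_ne_top [IsFiniteMeasure P] {Z : Ω → EReal}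
    (hZ : AEMeasurable Z P) {m : ℝ} (hm : ∀ᵐ ω ∂P, (m : EReal) ≤ Z ω)
    (htop : extExpectation P Z ≠ ⊤) :
    (∀ᵐ ω ∂P, Z ω ≠ ⊤) ∧ Integrable (fun ω => (Z ω).toReal) P ∧
      extExpectation P Z = ((∫ ω, (Z ω).toReal ∂P : ℝ) : EReal) := by
  have hpos : ∫⁻ ω, (Z ω).toENNReal ∂P ≠ ⊤ := by
    intro h
    exact htop (by simp [extExpectation, upperAdd, h])
  have hmeas : AEMeasurable (fun ω => (Z ω).toENNReal) P :=
    EReal.continuous_toENNReal.measurable.comp_aemeasurable hZ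
  have hfin : ∀ᵐ ω ∂P, Z ω ≠ ⊤ :=
    (ae_lt_top' hmeas hpos).mono fun ω hω => EReal.toENNReal_ne_top_iff.1 hω.ne
  have hint : Integrable (fun ω => (Z ω).toReal) P := by
    refine Integrable.mono' (g := fun ω => (Z ω).toENNReal.toReal + |m|)
      ((integrable_toReal_of_lintegral_ne_top hmeas hpos).add (integrable_const _))
      hZ.ereal_toReal.aestronglyMeasurable ?_
    filter_upwards [hm, hfin] with ω h1 h2
    have h3 : Z ω ≠ ⊥ := fun h => by simp [h] at h1
    lift Z ω to ℝ using ⟨h2, h3⟩ with z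
    have h4 : m ≤ z := by exact_mod_cast h1
    simp only [EReal.toReal_coe, EReal.real_coe_toENNReal, Real.norm_eq_abs,
      ENNReal.toReal_ofReal']
    rcases le_total 0 z with h | h
    · rw [abs_of_nonneg h]; linarith [le_max_left z 0, abs_nonneg m]
    · rw [abs_of_nonpos h]; linarith [le_max_right z 0, neg_abs_le m]
  refine ⟨hfin, hint, ?_⟩
  rw [← extExpectation_coe hint]
  refine extExpectation_congr_ae ?_
  filter_upwards [hm, hfin] with ω h1 h2
  have h3 : Z ω ≠ ⊥ := fun h => by simp [h] at h1
  exact (EReal.coe_toReal h2 h3).symm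

theorem extExpectation_le_of_forall_le [IsProbabilityMeasure P] {Z : Ω → EReal} {m : ℝ}
    (hm : 0 ≤ m) (h : ∀ᵐ ω ∂P, Z ω ≤ m) : extExpectation P Z ≤ m := by
  have hpos : ∫⁻ ω, (Z ω).toENNReal ∂P ≤ ENNReal.ofReal m := by
    calc ∫⁻ ω, (Z ω).toENNReal ∂P ≤ ∫⁻ _, ENNReal.ofReal m ∂P :=
          lintegral_mono_ae (h.mono fun ω hω => by
            simpa using EReal.toENNReal_le_toENNReal hω)
      _ = ENNReal.ofReal m := by simp
  have hpos' : ∫⁻ ω, (Z ω).toENNReal ∂P ≠ ⊤ := (hpos.trans_lt ENNReal.ofReal_lt_top).ne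
  have hcoe : ((∫⁻ ω, (Z ω).toENNReal ∂P : ℝ≥0∞) : EReal) ≤ m := by
    have := EReal.coe_ennreal_le_coe_ennreal_iff.2 hpos
    rwa [EReal.coe_ennreal_ofReal, max_eq_left hm] at this
  unfold extExpectation upperAdd
  rw [if_neg]
  · calc _ ≤ ((∫⁻ ω, (Z ω).toENNReal ∂P : ℝ≥0∞) : EReal) + 0 := by
          gcongr
          simpa using EReal.coe_ennreal_nonneg _
      _ ≤ m := by simpa using hcoe
  · simp [hpos', EReal.neg_eq_top_iff]

end ExtExpectation

/-! ### Separation by explicit densities -/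

section Duality

variable {Ω : Type*} [MeasurableSpace Ω] {P : Measure Ω}

/-- A nonnegative bounded density, suitably normalized, defines an absolutely continuous
probability that orders bounded random variables as their weighted integrals do. -/
theorem exists_absContProbs_of_density [IsProbabilityMeasure P] {D : Ω → ℝ} (hD : MemLp D ∞ P)
    (hD0 : ∀ᵐ ω ∂P, 0 ≤ D ω) (hpos : 0 < ∫ ω, D ω ∂P) :
    ∃ Q ∈ absContProbs P, ∀ Y Z : Ω → ℝ, MemLp Y ∞ P → MemLp Z ∞ P →
      ∫ ω, D ω * (Y ω - Z ω) ∂P ≤ 0 → ∫ ω, Y ω ∂Q ≤ ∫ ω, Z ω ∂Q := by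
  set c := ∫ ω, D ω ∂P with hc
  have hDint : Integrable D P := hD.integrable le_top
  have hmeas : AEMeasurable (fun ω => ENNReal.ofReal (D ω / c)) P :=
    (hDint.aemeasurable.div_const c).ennreal_ofReal
  have hprob : IsProbabilityMeasure (P.withDensity fun ω => ENNReal.ofReal (D ω / c)) := by
    refine ⟨?_⟩
    rw [withDensity_apply _ MeasurableSet.univ, Measure.restrict_univ,
      ← ofReal_integral_eq_lintegral_ofReal (hDint.div_const c)
        (hD0.mono fun ω hω => div_nonneg hω hpos.le),
      integral_div, ← hc, div_self hpos.ne', ENNReal.ofReal_one]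
  refine ⟨_, ⟨hprob, withDensity_absolutelyContinuous _ _⟩, fun Y Z hY hZ h => ?_⟩
  have key : ∀ W : Ω → ℝ, ∫ ω, W ω ∂(P.withDensity fun ω => ENNReal.ofReal (D ω / c)) =
      c⁻¹ * ∫ ω, D ω * W ω ∂P := by
    intro W
    rw [integral_withDensity_eq_integral_toReal_smul₀ hmeas
      (Filter.Eventually.of_forall fun _ => ENNReal.ofReal_lt_top), ← integral_const_mul]
    refine integral_congr_ae (hD0.mono fun ω hω => ?_)
    simp only [smul_eq_mul]
    rw [ENNReal.toReal_ofReal (div_nonneg hω hpos.le)]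
    ring
  have hint : ∀ W : Ω → ℝ, MemLp W ∞ P → Integrable (fun ω => D ω * W ω) P := fun W hW =>
    (MemLp.mul (p := ∞) (q := ∞) (r := ∞) hW hD).integrable le_top
  rw [key, key]
  refine mul_le_mul_of_nonneg_left ?_ (inv_nonneg.2 hpos.le)
  have : ∫ ω, D ω * (Y ω - Z ω) ∂P = ∫ ω, D ω * Y ω ∂P - ∫ ω, D ω * Z ω ∂P := by
    rw [← integral_sub (hint Y hY) (hint Z hZ)]
    exact integral_congr_ae (Filter.Eventually.of_forall fun ω => by simp only; ring)
  linarith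

/-- The right derivative is a subgradient: to the left of `x`, slopes are at most the left
derivative, hence at most the right one. -/
theorem ConvexOn.add_rightDeriv_mul_le {S : Set ℝ} {F : ℝ → ℝ} (hF : ConvexOn ℝ S F) {x y : ℝ}
    (hx : x ∈ interior S) (hy : y ∈ S) :
    F x + derivWithin F (Set.Ioi x) x * (y - x) ≤ F y := by
  rcases lt_trichotomy x y with h | rfl | h
  · have := hF.rightDeriv_le_slope_of_mem_interior hx hy h
    rw [slope_def_field, le_div_iff₀ (sub_pos.2 h)] at this
    linarith
  · simp
  · have := (hF.slope_le_leftDeriv_of_mem_interior hy hx h).trans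
      (hF.leftDeriv_le_rightDeriv_of_mem_interior hx)
    rw [slope_def_field, div_le_iff₀ (sub_pos.2 h)] at this
    nlinarith

theorem MemLp.exists_ae_abs_le {Y : Ω → ℝ} (hY : MemLp Y ∞ P) :
    ∃ C : ℝ, ∀ᵐ ω ∂P, |Y ω| ≤ C :=
  ⟨(eLpNorm Y ∞ P).toReal, by
    have h := ae_le_eLpNormEssSup (f := Y) (μ := P)
    filter_upwards [h] with ω hω
    have h2 := hY.eLpNorm_lt_top.ne
    rw [eLpNorm_exponent_top] at h2 ⊢
    simpa using ENNReal.toReal_mono h2 hω⟩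

theorem memLp_top_of_absolutelyContinuous {Q : Measure Ω} (hQ : Q ≪ P) {Y : Ω → ℝ}
    (hY : MemLp Y ∞ P) : MemLp Y ∞ Q := by
  obtain ⟨C, hC⟩ := MemLp.exists_ae_abs_le hY
  exact memLp_top_of_bound (hY.aestronglyMeasurable.mono_ac hQ) C (hQ.ae_le hC)

theorem memLp_top_comp_of_monotone [IsFiniteMeasure P] {G : ℝ → ℝ} (hG : Monotone G)
    {Y : Ω → ℝ} (hY : MemLp Y ∞ P) : MemLp (fun ω => G (Y ω)) ∞ P := by
  obtain ⟨C, hC⟩ := MemLp.exists_ae_abs_le hY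
  refine memLp_top_of_bound
    (hG.measurable.comp_aemeasurable hY.aestronglyMeasurable.aemeasurable).aestronglyMeasurable
    (max |G (-C)| |G C|) (hC.mono fun ω hω => ?_)
  rw [abs_le] at hω
  exact abs_le_max_abs_abs (hG hω.1) (hG hω.2)

theorem integrable_of_extExpectation_comp_ne_top [IsFiniteMeasure P] {f : ℝ → EReal}
    (hbot : ∀ x, f x ≠ ⊥) (hmono : Monotone f) {Y : Ω → ℝ} (hY : MemLp Y ∞ P)
    (h : extExpectation P (fun ω => f (Y ω)) ≠ ⊤) :
    (∀ᵐ ω ∂P, f (Y ω) ≠ ⊤) ∧ Integrable (fun ω => (f (Y ω)).toReal) P ∧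
      extExpectation P (fun ω => f (Y ω)) = ((∫ ω, (f (Y ω)).toReal ∂P : ℝ) : EReal) := by
  obtain ⟨C, hC⟩ := MemLp.exists_ae_abs_le hY
  -- `f (-C)` may be `⊤`; the minimum with `0` makes the lower bound real.
  refine exists_integrable_of_extExpectation_ne_top (m := (min (f (-C)) 0).toReal)
    (hmono.measurable.comp_aemeasurable hY.aestronglyMeasurable.aemeasurable) ?_ h
  filter_upwards [hC] with ω hω
  rw [EReal.coe_toReal (by simp) (by simp [hbot])]
  exact (min_le_left _ _).trans (hmono (abs_le.1 hω).1)

/-- If `Y` is a.s. bounded away from the right end of the domain of `f` and `E[f(Y)] > 1`, then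
the right derivative of `f` at `Y` is the density of a probability separating `Y` from the
acceptance set. -/
theorem exists_separating_of_le [IsProbabilityMeasure P] {f : ℝ → EReal} (hbot : ∀ x, f x ≠ ⊥)
    (hmono : Monotone f) (h0 : f 0 ≤ 1)
    (hconv : ConvexOn ℝ {x | f x ≠ ⊤} (fun x => (f x).toReal))
    {Y : Ω → ℝ} (hY : MemLp Y ∞ P) (hY1 : 1 < extExpectation P (fun ω => f (Y ω)))
    {s t : ℝ} (hst : s < t) (ht : f t ≠ ⊤) (hYs : ∀ᵐ ω ∂P, Y ω ≤ s) :
    ∃ Q ∈ absContProbs P, ∀ Z : Ω → ℝ, MemLp Z ∞ P →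
      extExpectation P (fun ω => f (Z ω)) ≤ 1 → ∫ ω, Z ω ∂Q ≤ ∫ ω, Y ω ∂Q := by
  set F : ℝ → ℝ := fun x => (f x).toReal with hF
  -- Truncating at `s` keeps `G` monotone on all of `ℝ`, hence `G ∘ Y` measurable and bounded,
  -- without changing it where `Y` lives.
  set G : ℝ → ℝ := fun x => derivWithin F (Set.Ioi (min x s)) (min x s) with hG
  have hlt : ∀ x, x ≤ t → f x ≠ ⊤ := fun x hx => ((hmono hx).trans_lt ht.lt_top).ne
  have hint : ∀ x, x ≤ s → x ∈ interior {x | f x ≠ ⊤} := fun x hx =>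
    mem_interior_iff_mem_nhds.2 (Filter.mem_of_superset (Iio_mem_nhds (hx.trans_lt hst))
      fun y hy => hlt y (le_of_lt hy))
  have hFmono : ∀ x y, x ≤ y → y ≤ t → F x ≤ F y := fun x y hxy hy =>
    EReal.toReal_le_toReal (hmono hxy) (hbot x) (hlt y hy)
  have hGmono : Monotone G := fun x y hxy =>
    hconv.monotoneOn_rightDeriv (hint _ (min_le_right _ _)) (hint _ (min_le_right _ _))
      (min_le_min_right s hxy)
  have hsub : ∀ x y, x ≤ s → f y ≠ ⊤ → F x + G x * (y - x) ≤ F y := fun x y hx hy => by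
    have := ConvexOn.add_rightDeriv_mul_le hconv (hint x hx) hy
    simpa only [hG, min_eq_left hx] using this
  have hG0 : ∀ x, 0 ≤ G x := fun x => by
    have h1 := hsub (min x s) (min x s - 1) (min_le_right _ _)
      (hlt _ (by linarith [min_le_right x s]))
    have h2 := hFmono (min x s - 1) (min x s) (by linarith) (by linarith [min_le_right x s])
    have h3 : G (min x s) = G x := by simp [hG]
    rw [h3] at h1
    linarith
  have hFY : Integrable (fun ω => F (Y ω)) P := by
    obtain ⟨C, hC⟩ := MemLp.exists_ae_abs_le hY
    refine Integrable.of_bound (C := max |F (-C)| |F s|)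
      (hmono.measurable.comp_aemeasurable
        hY.aestronglyMeasurable.aemeasurable).ereal_toReal.aestronglyMeasurable ?_
    filter_upwards [hC, hYs] with ω h1 h2
    exact abs_le_max_abs_abs (hFmono _ _ (abs_le.1 h1).1 (h2.trans hst.le))
      (hFmono _ _ h2 hst.le)
  have hFY1 : 1 < ∫ ω, F (Y ω) ∂P := by
    have : extExpectation P (fun ω => f (Y ω)) = ((∫ ω, F (Y ω) ∂P : ℝ) : EReal) := by
      rw [← extExpectation_coe hFY]
      exact extExpectation_congr_ae (hYs.mono fun ω hω =>
        (EReal.coe_toReal (hlt _ (hω.trans hst.le)) (hbot _)).symm)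
    rw [this] at hY1
    exact_mod_cast hY1
  have hf0 : f 0 ≠ ⊤ := fun h => (EReal.coe_ne_top 1) (top_le_iff.1 (h ▸ h0))
  have hF0 : F 0 ≤ 1 := by
    have := EReal.toReal_le_toReal h0 (hbot 0) (EReal.coe_ne_top 1)
    simpa using this
  have hD : MemLp (fun ω => G (Y ω)) ∞ P := memLp_top_comp_of_monotone hGmono hY
  have hprod : ∀ W : Ω → ℝ, MemLp W ∞ P → Integrable (fun ω => G (Y ω) * W ω) P := fun W hW =>
    (MemLp.mul (p := ∞) (q := ∞) (r := ∞) hW hD).integrable le_top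
  -- If the slope vanished a.s., `Y` would a.s. minimize `F`, so `F(Y) ≤ F(0) ≤ 1`, against `E[F(Y)]
  -- > 1`.
  have hDpos : 0 < ∫ ω, G (Y ω) ∂P := by
    refine lt_of_le_of_ne (integral_nonneg fun ω => hG0 _) fun h => ?_
    have hzero := (integral_eq_zero_iff_of_nonneg (fun ω => hG0 _) (hD.integrable le_top)).1 h.symm
    have : ∫ ω, F (Y ω) ∂P ≤ ∫ _, F 0 ∂P := by
      refine integral_mono_ae hFY (integrable_const _) ?_
      filter_upwards [hzero, hYs] with ω h1 h2
      have h3 := hsub (Y ω) 0 h2 hf0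
      have h4 : G (Y ω) = 0 := h1
      rw [h4] at h3
      linarith
    simp only [integral_const, probReal_univ, one_smul] at this
    linarith
  obtain ⟨Q, hQ, hQle⟩ := exists_absContProbs_of_density hD
    (Filter.Eventually.of_forall fun ω => hG0 _) hDpos
  refine ⟨Q, hQ, fun Z hZ hZ1 => hQle Z Y hZ hY ?_⟩
  obtain ⟨hZt, hZi, hZe⟩ := integrable_of_extExpectation_comp_ne_top hbot hmono hZ
    (hZ1.trans_lt (EReal.coe_lt_top 1)).ne
  have hFZ1 : ∫ ω, F (Z ω) ∂P ≤ 1 := by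
    rw [hZe] at hZ1
    exact_mod_cast hZ1
  -- The integrated subgradient inequality; its right side is at most `1 - E[F(Y)] < 0`.
  have : ∫ ω, G (Y ω) * (Z ω - Y ω) ∂P ≤ ∫ ω, (F (Z ω) - F (Y ω)) ∂P := by
    refine integral_mono_ae (hprod _ (hZ.sub hY)) (hZi.sub hFY) ?_
    filter_upwards [hZt, hYs] with ω h1 h2
    have := hsub (Y ω) (Z ω) h2 h1
    linarith
  rw [integral_sub hZi hFY] at this
  linarith

/-- Conditioning on `{Y > s}` separates `Y + (u - s)` from random variables bounded by `u`. -/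
theorem exists_separating_of_pos [IsProbabilityMeasure P] {f : ℝ → EReal} (hbot : ∀ x, f x ≠ ⊥)
    (hmono : Monotone f) {Y : Ω → ℝ} (hY : MemLp Y ∞ P) {s u : ℝ} (hu : f u = ⊤)
    (hYs : ¬ ∀ᵐ ω ∂P, Y ω ≤ s) :
    ∃ Q ∈ absContProbs P, ∀ Z : Ω → ℝ, MemLp Z ∞ P →
      extExpectation P (fun ω => f (Z ω)) ≤ 1 → ∫ ω, Z ω ∂Q ≤ ∫ ω, (Y ω + (u - s)) ∂Q := by
  set G : ℝ → ℝ := fun x => if s < x then 1 else 0 with hG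
  have hGmono : Monotone G := fun x y hxy => by
    simp only [hG]
    split_ifs with h1 h2
    · exact le_rfl
    · exact absurd (h1.trans_le hxy) h2
    · exact zero_le_one
    · exact le_rfl
  have hG0 : ∀ x, 0 ≤ G x := fun x => by simp only [hG]; split_ifs <;> norm_num
  have hD : MemLp (fun ω => G (Y ω)) ∞ P := memLp_top_comp_of_monotone hGmono hY
  have hDpos : 0 < ∫ ω, G (Y ω) ∂P := by
    refine lt_of_le_of_ne (integral_nonneg fun ω => hG0 _) fun h => hYs ?_
    have hzero := (integral_eq_zero_iff_of_nonneg (fun ω => hG0 _) (hD.integrable le_top)).1 h.symm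
    filter_upwards [hzero] with ω hω
    by_contra hlt
    simp [hG, not_le.1 hlt] at hω
  obtain ⟨Q, hQ, hQle⟩ := exists_absContProbs_of_density hD
    (Filter.Eventually.of_forall fun ω => hG0 _) hDpos
  refine ⟨Q, hQ, fun Z hZ hZ1 => hQle Z _ hZ (hY.add (memLp_const _)) ?_⟩
  have hZt := (integrable_of_extExpectation_comp_ne_top hbot hmono hZ
    (hZ1.trans_lt (EReal.coe_lt_top 1)).ne).1
  -- Acceptable `Z` stay a.s. below `u`, while `Y + (u - s) > u` on the conditioning event.
  refine integral_nonpos_of_ae (hZt.mono fun ω hω => ?_)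
  by_cases h : s < Y ω
  · have : Z ω < u := by
      by_contra hle
      exact hω (top_le_iff.1 (hu ▸ hmono (not_lt.1 hle)))
    simp only [hG, h, if_true, one_mul, Pi.zero_apply]
    linarith
  · simp [hG, h]

/-- The slack `δ` is split in two. Unless `Y` stays `δ / 2` below some point of the domain of `f`,
that domain is bounded above. A point `t` of it within `δ / 2` of its supremum then gives `f (t + δ
/ 2) = ⊤`, and conditioning on `Y > t - δ / 2` costs exactly `δ`. -/
theorem exists_separating [IsProbabilityMeasure P] {f : ℝ → EReal} (hbot : ∀ x, f x ≠ ⊥)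
    (hmono : Monotone f) (h0 : f 0 ≤ 1)
    (hconv : ConvexOn ℝ {x | f x ≠ ⊤} (fun x => (f x).toReal))
    {Y : Ω → ℝ} (hY : MemLp Y ∞ P) (hY1 : 1 < extExpectation P (fun ω => f (Y ω)))
    {δ : ℝ} (hδ : 0 < δ) :
    ∃ Q ∈ absContProbs P, ∀ Z : Ω → ℝ, MemLp Z ∞ P →
      extExpectation P (fun ω => f (Z ω)) ≤ 1 → ∫ ω, Z ω ∂Q ≤ ∫ ω, (Y ω + δ) ∂Q := by
  by_cases hcase : ∃ t, f t ≠ ⊤ ∧ ∀ᵐ ω ∂P, Y ω ≤ t - δ / 2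
  · obtain ⟨t, ht, hYt⟩ := hcase
    obtain ⟨Q, hQ, hQle⟩ := exists_separating_of_le hbot hmono h0 hconv hY hY1
      (by linarith) ht hYt
    refine ⟨Q, hQ, fun Z hZ hZ1 => (hQle Z hZ hZ1).trans ?_⟩
    have := hQ.1
    have hYQ : Integrable Y Q := (memLp_top_of_absolutelyContinuous hQ.2 hY).integrable le_top
    exact integral_mono hYQ (hYQ.add (integrable_const δ)) fun ω => by simp only; linarith
  · simp only [not_exists, not_and] at hcase
    obtain ⟨C, hC⟩ := MemLp.exists_ae_abs_le hY
    have hne : {t | f t ≠ ⊤}.Nonempty := ⟨0, fun h => (EReal.coe_ne_top 1) (top_le_iff.1 (h ▸ h0))⟩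
    have hbdd : BddAbove {t | f t ≠ ⊤} := ⟨C + δ / 2, fun t ht => by
      by_contra hlt
      refine hcase t ht (hC.mono fun ω hω => ?_)
      linarith [(abs_le.1 hω).2]⟩
    obtain ⟨t, ht, hlt⟩ := exists_lt_of_lt_csSup hne
      (show sSup {t | f t ≠ ⊤} - δ / 2 < sSup {t | f t ≠ ⊤} by linarith)
    have hu : f (t + δ / 2) = ⊤ := by
      by_contra h
      linarith [le_csSup hbdd h]
    obtain ⟨Q, hQ, hQle⟩ := exists_separating_of_pos hbot hmono hY hu (hcase t ht)
    refine ⟨Q, hQ, fun Z hZ hZ1 => ?_⟩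
    have := hQle Z hZ hZ1
    rwa [show t + δ / 2 - (t - δ / 2) = δ by ring] at this

end Duality

/-! ### Logarithmic change of variable and the two inequalities -/

section Orlicz

variable {Ω : Type*} [MeasurableSpace Ω] {P : Measure Ω}

theorem toNNReal_exp_combination (x y a b : ℝ) :
    (Real.exp (a * x + b * y)).toNNReal =
      (Real.exp x).toNNReal ^ a * (Real.exp y).toNNReal ^ b := by
  apply NNReal.eq
  rw [NNReal.coe_mul, NNReal.coe_rpow, NNReal.coe_rpow, Real.coe_toNNReal _ (Real.exp_pos _).le,
    Real.coe_toNNReal _ (Real.exp_pos _).le, Real.coe_toNNReal _ (Real.exp_pos _).le,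
    ← Real.exp_mul, ← Real.exp_mul, ← Real.exp_add]
  ring_nf

/-- GA-convexity is convexity on the logarithmic scale. -/
theorem convexOn_comp_exp_of_gaConvex {Φ : ℝ≥0 → EReal} (hGA : GAConvex Φ)
    (hbot : ∀ x, Φ (Real.exp x).toNNReal ≠ ⊥) :
    ConvexOn ℝ {x | Φ (Real.exp x).toNNReal ≠ ⊤} (fun x => (Φ (Real.exp x).toNNReal).toReal) := by
  have key : ∀ x y a b : ℝ, Φ (Real.exp x).toNNReal ≠ ⊤ → Φ (Real.exp y).toNNReal ≠ ⊤ →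
      0 < a → 0 < b → a + b = 1 → Φ (Real.exp (a * x + b * y)).toNNReal ≤
        ((a * (Φ (Real.exp x).toNNReal).toReal + b * (Φ (Real.exp y).toNNReal).toReal : ℝ) :
          EReal) := by
    intro x y a b hx hy ha hb hab
    obtain rfl : b = 1 - a := by linarith
    have h := hGA (Real.exp x).toNNReal (Real.exp y).toNNReal a ha (by linarith)
    rw [toNNReal_exp_combination]
    refine h.trans (le_of_eq ?_)
    rw [← upperAdd_coe, EReal.coe_mul, EReal.coe_mul, EReal.coe_toReal hx (hbot x),
      EReal.coe_toReal hy (hbot y)]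
  refine convexOn_iff_forall_pos.2 ⟨convex_iff_forall_pos.2 ?_, ?_⟩
  · intro x hx y hy a b ha hb hab
    exact ((key x y a b hx hy ha hb hab).trans_lt (EReal.coe_lt_top _)).ne
  · intro x hx y hy a b ha hb hab
    have := EReal.toReal_le_toReal (key x y a b hx hy ha hb hab) (hbot _) (EReal.coe_ne_top _)
    rwa [EReal.toReal_coe] at this

theorem MemLinftyPosPos.memLp_log {X : Ω → ℝ} (hX : MemLinftyPosPos P X) :
    MemLp (fun ω => Real.log (X ω)) ∞ P := by
  obtain ⟨hX, c, hc, hcX⟩ := hX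
  obtain ⟨C, hC⟩ := MemLp.exists_ae_abs_le hX
  refine memLp_top_of_bound
    (Real.measurable_log.comp_aemeasurable hX.aestronglyMeasurable.aemeasurable).aestronglyMeasurable
    (max |Real.log c| |Real.log C|) ?_
  filter_upwards [hC, hcX] with ω h1 h2
  exact abs_le_max_abs_abs (Real.log_le_log hc h2)
    (Real.log_le_log (hc.trans_le h2) (abs_le.1 h1).2)

theorem MemLinftyPosPos.ae_pos {X : Ω → ℝ} (hX : MemLinftyPosPos P X) : ∀ᵐ ω ∂P, 0 < X ω := by
  obtain ⟨-, c, hc, hcX⟩ := hX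
  exact hcX.mono fun ω hω => hc.trans_le hω

theorem MemLinftyPosPos.div_const {X : Ω → ℝ} (hX : MemLinftyPosPos P X) {k : ℝ} (hk : 0 < k) :
    MemLinftyPosPos P (fun ω => X ω / k) := by
  obtain ⟨hX, c, hc, hcX⟩ := hX
  refine ⟨?_, c / k, div_pos hc hk, hcX.mono fun ω hω => div_le_div_of_nonneg_right hω hk.le⟩
  simpa only [div_eq_inv_mul] using hX.const_mul k⁻¹

theorem memLinftyPosPos_one [IsFiniteMeasure P] : MemLinftyPosPos P (fun _ : Ω => (1 : ℝ)) :=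
  ⟨memLp_const _, 1, one_pos, Filter.Eventually.of_forall fun _ => le_rfl⟩

theorem geomMean_div_const {Q : Measure Ω} (hQ : Q ∈ absContProbs P) {X : Ω → ℝ}
    (hX : MemLinftyPosPos P X) {k : ℝ} (hk : 0 < k) :
    geomMean Q (fun ω => X ω / k) = ENNReal.ofReal k⁻¹ * geomMean Q X := by
  have := hQ.1
  have hint : Integrable (fun ω => Real.log (X ω)) Q :=
    (memLp_top_of_absolutelyContinuous hQ.2 hX.memLp_log).integrable le_top
  have : ∫ ω, Real.log (X ω / k) ∂Q = ∫ ω, Real.log (X ω) ∂Q - Real.log k := by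
    have h : ∫ ω, Real.log (X ω / k) ∂Q = ∫ ω, (Real.log (X ω) - Real.log k) ∂Q :=
      integral_congr_ae (Filter.Eventually.mono (hQ.2.ae_le hX.ae_pos) fun ω hω => Real.log_div hω.ne' hk.ne')
    rw [h, integral_sub hint (integrable_const _)]
    simp
  rw [geomMean, geomMean, this, Real.exp_sub, Real.exp_log hk,
    ← ENNReal.ofReal_mul (inv_nonneg.2 hk.le), div_eq_inv_mul]

theorem geomMean_ne_zero (Q : Measure Ω) (X : Ω → ℝ) : geomMean Q X ≠ 0 := by
  simp [geomMean, Real.exp_pos]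

theorem geomMean_ne_top (Q : Measure Ω) (X : Ω → ℝ) : geomMean Q X ≠ ⊤ := ENNReal.ofReal_ne_top

/-- The constant `1` is a competitor, because `Φ 1 ≤ 1`. -/
theorem orliczPenalty_le_one [IsProbabilityMeasure P] {Φ : ℝ≥0 → EReal}
    (hΦ : IsOrliczFunction Φ) (Q : Measure Ω) : orliczPenalty P Φ Q ≤ 1 := by
  refine ENNReal.inv_le_one.2 ?_
  refine le_trans ?_ (le_iSup₂ (fun _ : Ω => (1 : ℝ)) ⟨memLinftyPosPos_one, ?_⟩)
  · simp [geomMean]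
  · exact extExpectation_le_of_forall_le (m := 1) zero_le_one
      (Filter.Eventually.of_forall fun _ => hΦ.le_one _ (by simp))

theorem orliczPremium_eq_sInf {Φ : ℝ≥0 → EReal} {X : Ω → ℝ} (hX : MemLinftyPosPos P X) :
    orliczPremium P Φ X =
      sInf {k : ℝ | 0 < k ∧ extExpectation P (fun ω => Φ (X ω / k).toNNReal) ≤ 1} := by
  have : P {ω | X ω = 0} = 0 :=
    measure_mono_null (fun ω (hω : X ω = 0) => by simp [hω]) (ae_iff.1 hX.ae_pos)
  simp [orliczPremium, this]

theorem exists_admissible_scale [IsProbabilityMeasure P] {Φ : ℝ≥0 → EReal}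
    (hΦ : IsOrliczFunction Φ) {X : Ω → ℝ} (hX : MemLinftyPosPos P X) :
    {k : ℝ | 0 < k ∧ extExpectation P (fun ω => Φ (X ω / k).toNNReal) ≤ 1}.Nonempty := by
  obtain ⟨C, hC⟩ := MemLp.exists_ae_abs_le hX.1
  have hpos : (0 : ℝ) < max C 1 := lt_max_of_lt_right one_pos
  refine ⟨max C 1, hpos, extExpectation_le_of_forall_le (m := 1) zero_le_one ?_⟩
  filter_upwards [hC] with ω hω
  refine hΦ.le_one _ (Real.toNNReal_le_one.2 ((div_le_one hpos).2 ?_))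
  exact (abs_le.1 hω).2.trans (le_max_left _ _)

theorem orliczPenalty_mul_geomMean_le [IsProbabilityMeasure P] {Φ : ℝ≥0 → EReal}
    (hΦ : IsOrliczFunction Φ) {X : Ω → ℝ} (hX : MemLinftyPosPos P X) {Q : Measure Ω}
    (hQ : Q ∈ absContProbs P) :
    orliczPenalty P Φ Q * geomMean Q X ≤ ENNReal.ofReal (orliczPremium P Φ X) := by
  have hfin : orliczPenalty P Φ Q * geomMean Q X ≠ ⊤ :=
    ENNReal.mul_ne_top ((orliczPenalty_le_one hΦ Q).trans_lt ENNReal.one_lt_top).ne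
      (geomMean_ne_top Q X)
  rw [ENNReal.le_ofReal_iff_toReal_le hfin, orliczPremium_eq_sInf hX]
  · refine le_csInf (exists_admissible_scale hΦ hX) fun k ⟨hk, hk1⟩ => ?_
    refine ENNReal.toReal_le_of_le_ofReal hk.le ?_
    have hle : ENNReal.ofReal k⁻¹ * geomMean Q X ≤ (orliczPenalty P Φ Q)⁻¹ := by
      rw [← geomMean_div_const hQ hX hk, orliczPenalty, inv_inv]
      exact le_iSup₂ (f := fun Z _ => geomMean Q Z) _ ⟨hX.div_const hk, hk1⟩
    calc orliczPenalty P Φ Q * geomMean Q X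
        = ENNReal.ofReal k * (orliczPenalty P Φ Q * (ENNReal.ofReal k⁻¹ * geomMean Q X)) := by
          have h1 : ENNReal.ofReal k * ENNReal.ofReal k⁻¹ = 1 := by
            rw [← ENNReal.ofReal_mul hk.le, mul_inv_cancel₀ hk.ne', ENNReal.ofReal_one]
          calc _ = (ENNReal.ofReal k * ENNReal.ofReal k⁻¹) *
                (orliczPenalty P Φ Q * geomMean Q X) := by rw [h1, one_mul]
            _ = _ := by ring
      _ ≤ ENNReal.ofReal k * (orliczPenalty P Φ Q * (orliczPenalty P Φ Q)⁻¹) := by gcongr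
      -- Only an inequality: the product is `0` when the penalty vanishes.
      _ ≤ ENNReal.ofReal k * 1 := by gcongr; exact ENNReal.mul_inv_le_one _
      _ = ENNReal.ofReal k := mul_one _
  · rw [orliczPremium_eq_sInf hX]
    exact Real.sInf_nonneg fun k hk => hk.1.le

theorem exists_le_orliczPenalty_mul_geomMean [IsProbabilityMeasure P] {Φ : ℝ≥0 → EReal}
    (hΦ : IsOrliczFunction Φ) (hGA : GAConvex Φ) {X : Ω → ℝ} (hX : MemLinftyPosPos P X) {k : ℝ}
    (hk : 0 < k) (hkX : k < orliczPremium P Φ X) :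
    ∃ Q ∈ absContProbs P, ENNReal.ofReal k ≤ orliczPenalty P Φ Q * geomMean Q X := by
  -- The inadmissible scale `k'` gives the strict inequality `E > 1`; the gap down to `k` provides
  -- the slack.
  obtain ⟨k', hkk', hk'X⟩ := exists_between hkX
  have hk' : 0 < k' := hk.trans hkk'
  have hbot : ∀ x, Φ (Real.exp x).toNNReal ≠ ⊥ := fun x => hΦ.ne_bot _ (by simp [Real.exp_pos])
  have hmono : Monotone fun x => Φ (Real.exp x).toNNReal := fun x y hxy =>
    hΦ.mono (Real.toNNReal_le_toNNReal (Real.exp_le_exp.2 hxy))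
  have hexp : ∀ Z : Ω → ℝ, MemLinftyPosPos P Z →
      extExpectation P (fun ω => Φ (Real.exp (Real.log (Z ω))).toNNReal) =
        extExpectation P (fun ω => Φ (Z ω).toNNReal) := fun Z hZ =>
    extExpectation_congr_ae (hZ.ae_pos.mono fun ω hω => by simp only [Real.exp_log hω])
  have hY1 : 1 < extExpectation P
      (fun ω => Φ (Real.exp (Real.log (X ω / k'))).toNNReal) := by
    by_contra h
    rw [orliczPremium_eq_sInf hX] at hk'X
    exact notMem_of_lt_csInf hk'X ⟨0, fun _ hx => hx.1.le⟩
      ⟨hk', (hexp (fun ω => X ω / k') (hX.div_const hk')).symm.trans_le (not_lt.1 h)⟩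
  obtain ⟨Q, hQ, hQle⟩ := exists_separating hbot hmono (hΦ.le_one _ (by simp))
    (convexOn_comp_exp_of_gaConvex hGA hbot) (hX.div_const hk').memLp_log hY1
    (sub_pos.2 (Real.log_lt_log hk hkk'))
  refine ⟨Q, hQ, ?_⟩
  have hshift : ∫ ω, (Real.log (X ω / k') + (Real.log k' - Real.log k)) ∂Q =
      ∫ ω, Real.log (X ω / k) ∂Q :=
    integral_congr_ae (Filter.Eventually.mono (hQ.2.ae_le hX.ae_pos) fun ω hω => by
      simp only [Real.log_div hω.ne' hk'.ne', Real.log_div hω.ne' hk.ne']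
      ring)
  -- Separation says that `X / k` dominates every competitor in geometric mean under `Q`; inverting
  -- yields the bound.
  have hsup : (orliczPenalty P Φ Q)⁻¹ ≤ ENNReal.ofReal k⁻¹ * geomMean Q X := by
    rw [← geomMean_div_const hQ hX hk, orliczPenalty, inv_inv]
    refine iSup₂_le fun Z hZ => ENNReal.ofReal_le_ofReal (Real.exp_le_exp.2 ?_)
    rw [← hshift]
    exact hQle _ hZ.1.memLp_log ((hexp Z hZ.1).trans_le hZ.2)
  have hinv := ENNReal.inv_le_inv.2 hsup
  rw [inv_inv, ENNReal.mul_inv (Or.inr (geomMean_ne_top Q X)) (Or.inr (geomMean_ne_zero Q X)),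
    ← ENNReal.ofReal_inv_of_pos (inv_pos.2 hk), inv_inv] at hinv
  calc ENNReal.ofReal k = ENNReal.ofReal k * (geomMean Q X)⁻¹ * geomMean Q X := by
        rw [mul_assoc, ENNReal.inv_mul_cancel (geomMean_ne_zero Q X) (geomMean_ne_top Q X), mul_one]
    _ ≤ orliczPenalty P Φ Q * geomMean Q X := by gcongr

end Orlicz

theorem mainTheorem8 {Ω : Type*} [MeasurableSpace Ω] (P : Measure Ω) [IsProbabilityMeasure P]
    (Φ : ℝ≥0 → EReal) (hΦ : IsOrliczFunction Φ) (hGA : GAConvex Φ) :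
    (∀ Q ∈ absContProbs P, orliczPenalty P Φ Q ≤ 1) ∧
    ∀ X : Ω → ℝ, MemLinftyPosPos P X →
      ENNReal.ofReal (orliczPremium P Φ X) =
        ⨆ Q ∈ absContProbs P, orliczPenalty P Φ Q * geomMean Q X := by
  refine ⟨fun Q _ => orliczPenalty_le_one hΦ Q, fun X hX => le_antisymm ?_ ?_⟩
  · refine le_of_forall_lt fun c hc => ?_
    -- The intermediate `d` is a positive scale even when `c = 0`.
    obtain ⟨d, hcd, hd⟩ := exists_between hc
    have hd_top : d ≠ ⊤ := (hd.trans ENNReal.ofReal_lt_top).ne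
    have hdpos : 0 < d.toReal := ENNReal.toReal_pos (pos_of_gt hcd).ne' hd_top
    obtain ⟨Q, hQ, hle⟩ := exists_le_orliczPenalty_mul_geomMean hΦ hGA hX hdpos
      ((ENNReal.lt_ofReal_iff_toReal_lt hd_top).1 hd)
    rw [ENNReal.ofReal_toReal hd_top] at hle
    exact hcd.trans_le (hle.trans
      (le_iSup₂ (f := fun Q _ => orliczPenalty P Φ Q * geomMean Q X) Q hQ))
  · exact iSup₂_le fun Q hQ => orliczPenalty_mul_geomMean_le hΦ hX hQ
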